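/- Let $\Omega$ be a finite or countably infinite set, let $f:\Omega\to[0,\infty)$ (true counts) and $g:\Omega\to[0,\infty)$ (detector counts) with $\sum_{s\in\Omega}g(s)<\infty$, and write $F(A)=\sum_{s\in A}f(s)$, $G(A)=\sum_{s\in A}g(s)$ for $A\subseteq\Omega$. Let $S\subseteq\Omega$ be a region such that $g(s)>0$ for every $s\in S$ with $f(s)>0$, and suppose that the importance weights $w(s)=f(s)/g(s)$ satisfy $\sum_{s\in S}g(s)\,w(s)^2<\infty$ (automatic if $S$ is finite; terms with $g(s)=0$ count as $0$) and have positive variance on $S$: $$\sigma^2(S)=\sum_{s\in S}\frac{g(s)}{G(S)}\Big(w(s)-\frac{F(S)}{G(S)}\Big)^2>0$$ (in particular $G(S)>0$). For each $n$ let $s_1,\dots,s_n$ be independent samples from $\Omega$ with $\Pr[s_i=s]=g(s)/G(\Omega)$. Let $n(S)=|\{i:s_i\in S\}|$ be the (random) number of samples in $S$. Let $\hat F_{k\mathrm{DIS}}(S)=G(S)\cdot\frac1{n(S)}\sum_{i:s_i\in S}w(s_i)$ if $n(S)>0$, and $\hat F_{k\mathrm{DIS}}(S)=0$ if $n(S)=0$.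 Let $$\hat\sigma^2(S)=\frac1{n(S)}\sum_{i:s_i\in S}\Big(w(s_i)-\frac{\hat F_{k\mathrm{DIS}}(S)}{G(S)}\Big)^2 .$$ Then the probability that $n(S)>0$ and $\hat\sigma^2(S)>0$ tends to $1$ as $n\to\infty$, and the studentized statistic $$\frac{\hat F_{k\mathrm{DIS}}(S)-F(S)}{G(S)\cdot\hat\sigma(S)/\sqrt{n(S)}}$$ (given the value $0$ where $n(S)=0$ or $\hat\sigma(S)=0$) converges in distribution to $\mathcal N(0,1)$ as $n\to\infty$. -/

import Mathlib

open MeasureTheory ProbabilityTheory Filter Topology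

noncomputable section

namespace KDISCount

variable {Ω : Type*}

/-- The cumulative count of `f` over a region `S`: `F(S) = ∑_{s ∈ S} f(s)`, and likewise `G(S)`. -/
def total (f : Ω → ℝ) (S : Set Ω) : ℝ :=
  ∑' s : S, f s

/-- The importance weight `f(s) / g(s)` of a unit `s`. -/
def weight (f g : Ω → ℝ) (s : Ω) : ℝ :=
  f s / g s

/-- The importance-weight variance of the region `S`:
`σ²(S) = ∑_{s ∈ S} (g(s) / G(S)) (f(s) / g(s) - F(S) / G(S))²`. -/
def weightVar (f g : Ω → ℝ) (S : Set Ω) : ℝ :=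
  ∑' s : S, g s / total g S * (weight f g s - total f S / total g S) ^ 2

/-- `s₁, …, sₙ` are independent draws from all of `Ω` with probability proportional to `g`,
that is, from the density `g(s) / G(Ω)`. -/
structure IsSample {Ξ : Type*} [MeasurableSpace Ω] [MeasurableSpace Ξ] (P : Measure Ξ)
    (g : Ω → ℝ) {n : ℕ} (X : Fin n → Ξ → Ω) : Prop where
  measurable : ∀ i, Measurable (X i)
  indep : iIndepFun X P
  law : ∀ i s, P.real (X i ⁻¹' {s}) = g s / total g Set.univ

section Estimators

variable {n : ℕ}

open Classical in
/-- The indices of the samples that land in `S`. -/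
def samplesIn (S : Set Ω) (x : Fin n → Ω) : Finset (Fin n) :=
  Finset.univ.filter fun i => x i ∈ S

/-- `n(S)`, the number of samples that land in `S`. -/
def sampleSize (S : Set Ω) (x : Fin n → Ω) : ℕ :=
  (samplesIn S x).card

/-- The average importance weight of the samples that land in `S`. -/
def avgWeight (f g : Ω → ℝ) (S : Set Ω) (x : Fin n → Ω) : ℝ :=
  1 / (sampleSize S x : ℝ) * ∑ i ∈ samplesIn S x, weight f g (x i)

/-- The `k`-DISCount estimator of `F(S)`. -/
def estimator (f g : Ω → ℝ) (S : Set Ω) (x : Fin n → Ω) : ℝ :=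
  if 0 < sampleSize S x then total g S * avgWeight f g S x else 0

/-- The empirical importance-weight variance `σ̂²(S)` over the samples that land in `S`. -/
def empVar (f g : Ω → ℝ) (S : Set Ω) (x : Fin n → Ω) : ℝ :=
  1 / (sampleSize S x : ℝ) *
    ∑ i ∈ samplesIn S x, (weight f g (x i) - estimator f g S x / total g S) ^ 2

/-- The studentized statistic `(F̂(S) - F(S)) / (G(S) σ̂(S) / √n(S))`; it has the value `0` on the
event that `n(S) = 0` or `σ̂(S) = 0`, where the quotient is undefined. -/
def studentized (f g : Ω → ℝ) (S : Set Ω) (x : Fin n → Ω) : ℝ :=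
  (estimator f g S x - total f S) /
    (total g S * √(empVar f g S x) / √(sampleSize S x : ℝ))

end Estimators

end KDISCount

end

noncomputable section

namespace KDISCount

variable {Ω : Type*}

/-! ### Exact finite-sample identities -/

section Deterministic

variable {n : ℕ} (f g : Ω → ℝ) (S : Set Ω)

/-! Conditioning on the random size `n(S)` is avoided: with `d = 1_S (w - F(S)/G(S))`, the statistic
equals `n^{-1/2} ∑ d(s_i)` divided by `√(n(S) σ̂² / n)` (`studentized_eq`), where both sums run over
all `n` draws. A single draw has `E d = 0` and `E d² = v = G(S) σ²(S) / G(Ω) > 0`. The central limit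
theorem gives the numerator the limit `N(0, v)`, the strong law sends `n(S) σ̂² / n` to `v`, and
Slutsky's theorem combines them.

Almost sure limits need one probability space, whereas the samples live on unrelated spaces `Ξ n`.
Both conclusions depend only on the joint law of each sample, so the limits are proved for the
coordinates of an infinite product and carried over by `IsSample.map_eq_map`. -/

/-- The deviation of the importance weight from its mean over `S`, extended by `0` off `S`. -/
def deviation : Ω → ℝ :=
  S.indicator fun s => weight f g s - total f S / total g S

lemma sampleSize_eq_sum (x : Fin n → Ω) :
    (sampleSize S x : ℝ) = ∑ i, S.indicator (fun _ => (1 : ℝ)) (x i) := by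
  classical
  simp [sampleSize, samplesIn, Set.indicator_apply]

lemma sum_samplesIn (h : Ω → ℝ) (x : Fin n → Ω) :
    ∑ i ∈ samplesIn S x, h (x i) = ∑ i, S.indicator h (x i) := by
  classical
  simp [samplesIn, Set.indicator_apply, Finset.sum_ite]

variable {f g S}

lemma avgWeight_sub (x : Fin n → Ω) (hN : sampleSize S x ≠ 0) :
    avgWeight f g S x - total f S / total g S =
      (∑ i, deviation f g S (x i)) / sampleSize S x := by
  have hN' : (sampleSize S x : ℝ) ≠ 0 := by exact_mod_cast hN
  have h : ∑ i, deviation f g S (x i) =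
      ∑ i ∈ samplesIn S x, weight f g (x i) - sampleSize S x * (total f S / total g S) := by
    unfold deviation
    rw [← sum_samplesIn S (fun s => weight f g s - total f S / total g S) x,
      Finset.sum_sub_distrib, Finset.sum_const, nsmul_eq_mul, sampleSize]
  rw [h, avgWeight]
  field_simp

/-- Recentring a sum of squares from the empirical mean to the true mean. With `n(S) = 0` both sides
vanish, since division by zero gives `0`. -/
lemma sampleSize_mul_empVar (hG : total g S ≠ 0) (x : Fin n → Ω) :
    sampleSize S x * empVar f g S x =
      ∑ i, deviation f g S (x i) ^ 2 - (∑ i, deviation f g S (x i)) ^ 2 / sampleSize S x := by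
  rcases Nat.eq_zero_or_pos (sampleSize S x) with hN | hN
  · have hmem : ∀ i, x i ∉ S := by
      intro i hi
      have : samplesIn S x = ∅ := Finset.card_eq_zero.mp hN
      simpa [samplesIn, hi] using Finset.eq_empty_iff_forall_notMem.mp this i
    simp [hN, deviation, hmem]
  · have hN' : (sampleSize S x : ℝ) ≠ 0 := by exact_mod_cast hN.ne'
    have hest : estimator f g S x / total g S = avgWeight f g S x := by
      rw [estimator, if_pos hN, mul_div_cancel_left₀ _ hG]
    have hd : ∑ i, deviation f g S (x i) =
        ∑ i ∈ samplesIn S x, (weight f g (x i) - total f S / total g S) :=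
      (sum_samplesIn S (fun s => weight f g s - total f S / total g S) x).symm
    have hd2 : ∑ i, deviation f g S (x i) ^ 2 =
        ∑ i ∈ samplesIn S x, (weight f g (x i) - total f S / total g S) ^ 2 := by
      rw [sum_samplesIn S (fun s => (weight f g s - total f S / total g S) ^ 2) x]
      refine Finset.sum_congr rfl fun i _ => ?_
      by_cases hi : x i ∈ S <;> simp [deviation, hi]
    have havg := avgWeight_sub (f := f) (g := g) x hN.ne'
    rw [empVar, hest, ← mul_assoc, mul_one_div_cancel hN', one_mul]
    have hexp : ∀ i ∈ samplesIn S x, (weight f g (x i) - avgWeight f g S x) ^ 2 =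
        (weight f g (x i) - total f S / total g S) ^ 2
        - 2 * ((∑ i, deviation f g S (x i)) / sampleSize S x) *
          (weight f g (x i) - total f S / total g S)
        + ((∑ i, deviation f g S (x i)) / sampleSize S x) ^ 2 := by
      intro i _
      rw [← havg]; ring
    rw [Finset.sum_congr rfl hexp, Finset.sum_add_distrib, Finset.sum_sub_distrib,
      ← Finset.mul_sum, ← hd, ← hd2, Finset.sum_const, nsmul_eq_mul]
    change _ - _ + (sampleSize S x : ℝ) * _ = _
    field_simp
    ring

lemma empVar_nonneg (x : Fin n → Ω) : 0 ≤ empVar f g S x :=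
  mul_nonneg (by positivity) (Finset.sum_nonneg fun _ _ => sq_nonneg _)

/-- `G(S)` and `√n` cancel. Where `n(S)` or `σ̂` is zero both sides are `0`, so no exceptional event
has to be removed. -/
lemma studentized_eq (hG : total g S ≠ 0) (x : Fin n → Ω) :
    studentized f g S x =
      (√n)⁻¹ * (∑ i, deviation f g S (x i)) * (√(sampleSize S x * empVar f g S x / n))⁻¹ := by
  rcases Nat.eq_zero_or_pos (sampleSize S x) with hN | hN
  · simp [studentized, hN]
  · have hN' : (0 : ℝ) < sampleSize S x := by exact_mod_cast hN
    have hn : (0 : ℝ) < n := by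
      have : sampleSize S x ≤ n := by
        simpa [sampleSize] using Finset.card_le_univ (samplesIn S x)
      exact_mod_cast hN.trans_le this
    have hnum : estimator f g S x - total f S =
        total g S * ((∑ i, deviation f g S (x i)) / sampleSize S x) := by
      rw [← avgWeight_sub x hN.ne', estimator, if_pos hN]
      field_simp
    rw [studentized, hnum, Real.sqrt_div' _ hn.le, Real.sqrt_mul hN'.le]
    rcases eq_or_ne (√(empVar f g S x)) 0 with hv | hv
    · simp [hv]
    · have h1 : √(sampleSize S x : ℝ) ≠ 0 := (Real.sqrt_pos.mpr hN').ne'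
      have h2 : √(n : ℝ) ≠ 0 := (Real.sqrt_pos.mpr hn).ne'
      have h3 : √(sampleSize S x : ℝ) ^ 2 = sampleSize S x := Real.sq_sqrt hN'.le
      field_simp
      rw [h3]

end Deterministic

/-! ### Moments of a single draw -/

section Moments

variable {f g : Ω → ℝ} {S : Set Ω}

lemma total_pos_of_weightVar_pos (hg : ∀ s, 0 ≤ g s) (hvar : 0 < weightVar f g S) :
    0 < total g S := by
  refine lt_of_le_of_ne (tsum_nonneg fun _ => hg _) fun h => hvar.ne' ?_
  simp [weightVar, ← h]

lemma mul_weight_eq (hf : ∀ s, 0 ≤ f s) (hfg : ∀ s ∈ S, 0 < f s → 0 < g s) {s : Ω} (hs : s ∈ S) :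
    g s * weight f g s = f s := by
  rcases (hf s).eq_or_lt with h | h
  · simp [weight, ← h]
  · exact mul_div_cancel₀ _ (hfg s hs h).ne'

lemma summable_of_summable_mul_weight_sq (hf : ∀ s, 0 ≤ f s) (hg : ∀ s, 0 ≤ g s)
    (hgsum : Summable g) (hfg : ∀ s ∈ S, 0 < f s → 0 < g s)
    (hfin : Summable fun s : S => g s * weight f g s ^ 2) : Summable fun s : S => f s := by
  refine Summable.of_nonneg_of_le (fun s => hf s) (fun s => ?_)
    ((hgsum.subtype S).add hfin)
  have h := mul_weight_eq hf hfg s.2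
  -- Expanding `g (w - 1)² ≥ 0` gives `2 f = 2 g w ≤ g + g w²`.
  have := mul_nonneg (hg s) (sq_nonneg (weight f g s - 1))
  have := mul_nonneg (hg s) (sq_nonneg (weight f g s))
  simp only [Function.comp_apply]
  nlinarith [hf s, hg s]

lemma hasSum_mul_deviation (hf : ∀ s, 0 ≤ f s)
    (hgsum : Summable g) (hfg : ∀ s ∈ S, 0 < f s → 0 < g s)
    (hfsum : Summable fun s : S => f s) (hG : total g S ≠ 0) :
    HasSum (fun s : S => g s * (weight f g s - total f S / total g S)) 0 := by
  have h := hfsum.hasSum.sub ((hgsum.subtype S).hasSum.mul_right (total f S / total g S))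
  have h0 : total f S - total g S * (total f S / total g S) = 0 := by
    field_simp
    ring
  rw [← h0]
  have heq : (fun s : S => g s * (weight f g s - total f S / total g S)) =
      fun s : S => f s - g s * (total f S / total g S) :=
    funext fun s => by rw [mul_sub, mul_weight_eq hf hfg s.2]
  rw [heq]
  exact h

lemma hasSum_mul_deviation_sq (hf : ∀ s, 0 ≤ f s)
    (hgsum : Summable g) (hfg : ∀ s ∈ S, 0 < f s → 0 < g s)
    (hfsum : Summable fun s : S => f s)
    (hfin : Summable fun s : S => g s * weight f g s ^ 2) (hG : total g S ≠ 0) :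
    HasSum (fun s : S => g s * (weight f g s - total f S / total g S) ^ 2)
      (total g S * weightVar f g S) := by
  have h : Summable fun s : S => g s * (weight f g s - total f S / total g S) ^ 2 := by
    refine ((hfin.sub (hfsum.mul_left (2 * (total f S / total g S)))).add
      ((hgsum.subtype S).mul_right ((total f S / total g S) ^ 2))).congr fun s => ?_
    rw [← mul_weight_eq hf hfg s.2]
    simp only [Function.comp_apply]
    ring
  convert h.hasSum using 1
  rw [weightVar, ← tsum_mul_left]
  refine tsum_congr fun s => ?_
  field_simp

/-- On a countable discrete space `μ` is the sum of its atoms, so integrals are series; real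
summability is already absolute. -/
lemma integrable_indicator_and_integral_eq [Countable Ω] [MeasurableSpace Ω]
    [DiscreteMeasurableSpace Ω] {μ : Measure Ω} [IsFiniteMeasure μ] {c a : ℝ}
    (hμ : ∀ s, μ.real {s} = g s / c) {h : Ω → ℝ} (hsum : HasSum (fun s : S => g s * h s) a) :
    Integrable (S.indicator h) μ ∧ ∫ s, S.indicator h s ∂μ = a / c := by
  have hs : HasSum (fun s => μ.real {s} * S.indicator h s) (a / c) := by
    have := (hasSum_subtype_iff_indicator (f := fun s => g s * h s) (s := S)).mp hsum
    have heq : (fun s => μ.real {s} * S.indicator h s) =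
        fun s => S.indicator (fun s => g s * h s) s / c := by
      ext s
      by_cases hs : s ∈ S <;> simp [hμ, hs]
      ring
    rw [heq]
    exact this.div_const c
  have habs : Summable fun s => (μ {s}).toReal * ‖S.indicator h s‖ := by
    refine hs.summable.abs.congr fun s => ?_
    rw [abs_mul, abs_of_nonneg measureReal_nonneg]
    rfl
  have hfin : ∀ s, μ {s} ≠ ⊤ := fun s => measure_ne_top μ _
  have hint := integrable_sum_dirac (x := fun s : Ω => s) hfin habs
  have hval := hasSum_integral_sum_dirac (x := fun s : Ω => s) hfin habs
  rw [Measure.sum_smul_dirac] at hint hval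
  exact ⟨hint, hval.unique hs⟩

end Moments

/-! ### Replacing the samples by coordinates of an infinite product -/

section Coupling

variable [Countable Ω] [MeasurableSpace Ω] [DiscreteMeasurableSpace Ω] {g : Ω → ℝ} {n : ℕ}
  {Ξ Ψ : Type*} [MeasurableSpace Ξ] [MeasurableSpace Ψ]
  {P : Measure Ξ} [IsProbabilityMeasure P] {Q : Measure Ψ} [IsProbabilityMeasure Q]

/-- All samples of size `n` have the same joint law. -/
lemma IsSample.map_eq_map {X : Fin n → Ξ → Ω} {Y : Fin n → Ψ → Ω}
    (hX : IsSample P g X) (hY : IsSample Q g Y) :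
    P.map (fun ω i => X i ω) = Q.map (fun ω i => Y i ω) := by
  rw [(iIndepFun_iff_map_fun_eq_pi_map fun i => (hX.measurable i).aemeasurable).mp hX.indep,
    (iIndepFun_iff_map_fun_eq_pi_map fun i => (hY.measurable i).aemeasurable).mp hY.indep]
  congr 1
  ext1 i
  refine Measure.ext_of_singleton fun s => ?_
  rw [Measure.map_apply (hX.measurable i) (measurableSet_singleton s),
    Measure.map_apply (hY.measurable i) (measurableSet_singleton s),
    ← measureReal_eq_measureReal_iff, hX.law, hY.law]

lemma isSample_infinitePi {μ : Measure Ω} [IsProbabilityMeasure μ]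
    (hμ : ∀ s, μ.real {s} = g s / total g Set.univ) :
    IsSample (Measure.infinitePi fun _ : ℕ => μ) g (fun (i : Fin n) ω => ω i) where
  measurable i := by fun_prop
  indep := (iIndepFun_infinitePi (P := fun _ : ℕ => μ) (X := fun _ s => s)
    (fun _ => measurable_id)).precomp Fin.val_injective
  law i s := by
    rw [← hμ s, measureReal_def, measureReal_def,
      (measurePreserving_eval_infinitePi (fun _ : ℕ => μ) (i : ℕ)).measure_preimage
        (measurableSet_singleton s).nullMeasurableSet]

end Coupling

/-! ### Strong law and central limit theorem -/

section Limits

variable [MeasurableSpace Ω] [DiscreteMeasurableSpace Ω]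
  {μ : Measure Ω} [IsProbabilityMeasure μ]

lemma iIndepFun_comp_eval (h : Ω → ℝ) :
    iIndepFun (fun (k : ℕ) (ω : ℕ → Ω) => h (ω k)) (Measure.infinitePi fun _ : ℕ => μ) :=
  iIndepFun_infinitePi (P := fun _ : ℕ => μ) (X := fun _ => h) fun _ => Measurable.of_discrete

lemma identDistrib_comp_eval (h : Ω → ℝ) (k : ℕ) :
    IdentDistrib (fun ω : ℕ → Ω => h (ω k)) h (Measure.infinitePi fun _ : ℕ => μ) μ where
  aemeasurable_fst := (Measurable.of_discrete.comp (measurable_pi_apply k)).aemeasurable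
  aemeasurable_snd := Measurable.of_discrete.aemeasurable
  map_eq := by
    have := (measurePreserving_eval_infinitePi (fun _ : ℕ => μ) k).map_eq
    conv_rhs => rw [← this]
    exact (Measure.map_map (f := Function.eval k) Measurable.of_discrete
      (measurable_pi_apply k)).symm

lemma ae_tendsto_average {h : Ω → ℝ} (hint : Integrable h μ) :
    ∀ᵐ ω ∂(Measure.infinitePi fun _ : ℕ => μ),
      Tendsto (fun n : ℕ => (∑ i : Fin n, h (ω i)) / n) atTop (𝓝 (∫ s, h s ∂μ)) := by
  have := strong_law_ae_real (μ := Measure.infinitePi fun _ : ℕ => μ)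
    (fun (k : ℕ) (ω : ℕ → Ω) => h (ω k))
    ((identDistrib_comp_eval h 0).integrable_iff.mpr hint)
    (fun i j hij => (iIndepFun_comp_eval h).indepFun hij)
    (fun i => (identDistrib_comp_eval h i).trans (identDistrib_comp_eval h 0).symm)
  filter_upwards [this] with ω hω
  rw [(identDistrib_comp_eval h 0).integral_eq] at hω
  simpa only [Fin.sum_univ_eq_sum_range (fun k => h (ω k))] using hω

/-- The central limit theorem for the coordinates of an infinite product. -/
lemma tendstoInDistribution_sum_eval {h : Ω → ℝ} (h0 : ∫ s, h s ∂μ = 0)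
    (h1 : ∫ s, h s ^ 2 ∂μ = 1) :
    TendstoInDistribution (fun (n : ℕ) (ω : ℕ → Ω) => (√n)⁻¹ * ∑ i : Fin n, h (ω i)) atTop
      (id : ℝ → ℝ) (fun _ => Measure.infinitePi fun _ : ℕ => μ) (gaussianReal 0 1) := by
  have := tendstoInDistribution_inv_sqrt_mul_sum (P := Measure.infinitePi fun _ : ℕ => μ)
    (X := fun (k : ℕ) (ω : ℕ → Ω) => h (ω k)) (Y := (id : ℝ → ℝ)) (P' := gaussianReal 0 1)
    HasLaw.id ((identDistrib_comp_eval h 0).integral_eq.trans h0)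
    ((identDistrib_comp_eval (fun s => h s ^ 2) 0).integral_eq.trans h1)
    (iIndepFun_comp_eval h)
    (fun i => (identDistrib_comp_eval h i).trans (identDistrib_comp_eval h 0).symm)
  refine this.congr (fun n => ae_of_all _ fun ω => ?_) (ae_of_all _ fun _ => rfl)
  simp only [Fin.sum_univ_eq_sum_range (fun k => h (ω k)) n]

variable [Countable Ω] {f g : Ω → ℝ} {S : Set Ω}

lemma ae_tendsto_sampleSize_mul_empVar (hf : ∀ s, 0 ≤ f s)
    (hgsum : Summable g) (hfg : ∀ s ∈ S, 0 < f s → 0 < g s)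
    (hfsum : Summable fun s : S => f s)
    (hfin : Summable fun s : S => g s * weight f g s ^ 2) (hG : total g S ≠ 0)
    (hGu : total g Set.univ ≠ 0) (hμ : ∀ s, μ.real {s} = g s / total g Set.univ) :
    ∀ᵐ ω ∂(Measure.infinitePi fun _ : ℕ => μ),
      Tendsto (fun n : ℕ => sampleSize S (fun i : Fin n => ω i) *
        empVar f g S (fun i : Fin n => ω i) / n) atTop
        (𝓝 (total g S * weightVar f g S / total g Set.univ)) := by
  have hgS : HasSum (fun s : S => g s * 1) (total g S) := by
    simp only [mul_one]
    exact (hgsum.subtype S).hasSum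
  have hA := integrable_indicator_and_integral_eq (S := S) (h := fun _ => 1) hμ hgS
  have hD := integrable_indicator_and_integral_eq (S := S)
    (h := fun s => weight f g s - total f S / total g S) hμ
    (hasSum_mul_deviation hf hgsum hfg hfsum hG)
  have hD2 := integrable_indicator_and_integral_eq (S := S)
    (h := fun s => (weight f g s - total f S / total g S) ^ 2) hμ
    (hasSum_mul_deviation_sq hf hgsum hfg hfsum hfin hG)
  filter_upwards [ae_tendsto_average hA.1, ae_tendsto_average hD.1, ae_tendsto_average hD2.1]
    with ω hωA hωD hωD2
  rw [hA.2] at hωA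
  rw [hD.2, zero_div] at hωD
  rw [hD2.2] at hωD2
  -- The recentring term over `n` is `(∑ d / n)² / (n(S) / n)`, which tends to `0² / (G(S)/G(Ω)) =
  -- 0`.
  have key := hωD2.sub ((hωD.pow 2).div hωA (div_ne_zero hG hGu))
  rw [zero_pow two_ne_zero, zero_div, sub_zero] at key
  refine key.congr fun n => ?_
  have hsq : ∀ s, S.indicator (fun s => (weight f g s - total f S / total g S) ^ 2) s =
      deviation f g S s ^ 2 := by
    intro s
    by_cases hs : s ∈ S <;> simp [deviation, hs]
  rw [sampleSize_mul_empVar hG, sampleSize_eq_sum]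
  simp only [hsq]
  change _ - ((∑ i : Fin n, deviation f g S (ω i)) / n) ^ 2 / _ = _
  rcases Nat.eq_zero_or_pos n with rfl | hn
  · simp
  · have : (n : ℝ) ≠ 0 := by exact_mod_cast hn.ne'
    field_simp

end Limits

/-! ### Slutsky's theorem and positivity of the empirical variance -/

section Transfer

variable [Countable Ω] [MeasurableSpace Ω] [DiscreteMeasurableSpace Ω]
  {μ : Measure Ω} [IsProbabilityMeasure μ] {f g : Ω → ℝ} {S : Set Ω}

lemma measurable_comp_sample {n : ℕ} {E : Type*} [MeasurableSpace E] (T : (Fin n → Ω) → E) :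
    Measurable fun ω : ℕ → Ω => T (fun i => ω i) :=
  (Measurable.of_discrete (f := T)).comp
    (measurable_pi_lambda _ fun i => measurable_pi_apply (i : ℕ))

lemma tendstoInDistribution_studentized (hG : total g S ≠ 0) {v : ℝ} (hv : 0 < v)
    (h0 : ∫ s, deviation f g S s ∂μ = 0) (h2 : ∫ s, deviation f g S s ^ 2 ∂μ = v)
    (hlim : ∀ᵐ ω ∂(Measure.infinitePi fun _ : ℕ => μ),
      Tendsto (fun n : ℕ => sampleSize S (fun i : Fin n => ω i) *
        empVar f g S (fun i : Fin n => ω i) / n) atTop (𝓝 v)) :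
    TendstoInDistribution (fun (n : ℕ) (ω : ℕ → Ω) => studentized f g S (fun i : Fin n => ω i))
      atTop (id : ℝ → ℝ) (fun _ => Measure.infinitePi fun _ : ℕ => μ) (gaussianReal 0 1) := by
  have hτ : √v ≠ 0 := (Real.sqrt_pos.mpr hv).ne'
  -- Dividing by `√v` makes the variance one; the factor `√v` is returned in `hscale`.
  have hclt := tendstoInDistribution_sum_eval (μ := μ) (h := fun s => deviation f g S s / √v)
    (by rw [integral_div, h0, zero_div])
    (by simp only [div_pow]; rw [integral_div, h2, Real.sq_sqrt hv.le, div_self hv.ne'])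
  have hmeas : ∀ n : ℕ, Measurable fun ω : ℕ → Ω =>
      √v * (√(sampleSize S (fun i : Fin n => ω i) *
        empVar f g S (fun i : Fin n => ω i) / n))⁻¹ := fun n =>
    measurable_comp_sample fun x : Fin n → Ω => √v * (√(sampleSize S x * empVar f g S x / n))⁻¹
  have hscale : TendstoInMeasure (Measure.infinitePi fun _ : ℕ => μ)
      (fun (n : ℕ) (ω : ℕ → Ω) => √v * (√(sampleSize S (fun i : Fin n => ω i) *
        empVar f g S (fun i : Fin n => ω i) / n))⁻¹) atTop (fun _ => 1) := by
    refine tendstoInMeasure_of_tendsto_ae (fun n => (hmeas n).aestronglyMeasurable) ?_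
    filter_upwards [hlim] with ω hω
    have := (hω.sqrt.inv₀ hτ).const_mul (√v)
    rwa [mul_inv_cancel₀ hτ] at this
  have hprod := hclt.continuous_comp_prodMk_of_tendstoInMeasure_const
    (g := fun p : ℝ × ℝ => p.1 * p.2) (by fun_prop) hscale fun n => (hmeas n).aemeasurable
  refine hprod.congr (fun n => ae_of_all _ fun ω => ?_) (ae_of_all _ fun x => by simp)
  simp only
  rw [studentized_eq hG, ← Finset.sum_div]
  field_simp

/-- Where positivity fails, `n(S) σ̂² / n = 0` lies at distance exactly `v` from its limit, so
convergence in measure with `ε = v` suffices. -/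
lemma tendsto_measureReal_empVar_pos {v : ℝ} (hv : 0 < v)
    (hlim : ∀ᵐ ω ∂(Measure.infinitePi fun _ : ℕ => μ),
      Tendsto (fun n : ℕ => sampleSize S (fun i : Fin n => ω i) *
        empVar f g S (fun i : Fin n => ω i) / n) atTop (𝓝 v)) :
    Tendsto (fun n : ℕ => (Measure.infinitePi fun _ : ℕ => μ).real
      {ω | 0 < sampleSize S (fun i : Fin n => ω i) ∧
        0 < empVar f g S (fun i : Fin n => ω i)}) atTop (𝓝 1) := by
  have hmeas : ∀ n : ℕ, Measurable fun ω : ℕ → Ω =>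
      (sampleSize S (fun i : Fin n => ω i) * empVar f g S (fun i : Fin n => ω i) / n : ℝ) :=
    fun n => measurable_comp_sample fun x : Fin n → Ω =>
      (sampleSize S x * empVar f g S x / n : ℝ)
  have hin := tendstoInMeasure_iff_measureReal_dist.mp
    (tendstoInMeasure_of_tendsto_ae (fun n => (hmeas n).aestronglyMeasurable) hlim) v hv
  refine tendsto_of_tendsto_of_tendsto_of_le_of_le (by simpa using hin.const_sub 1)
    tendsto_const_nhds (fun n => ?_) (fun n => measureReal_le_one)
  have hset : MeasurableSet {ω : ℕ → Ω | 0 < sampleSize S (fun i : Fin n => ω i) ∧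
      0 < empVar f g S (fun i : Fin n => ω i)} :=
    measurableSet_setOfPred.mpr (measurable_comp_sample fun x : Fin n → Ω =>
      0 < sampleSize S x ∧ 0 < empVar f g S x)
  have hcompl := probReal_compl_eq_one_sub (μ := Measure.infinitePi fun _ : ℕ => μ) hset
  have hle := measureReal_mono (μ := Measure.infinitePi fun _ : ℕ => μ)
    (s₁ := {ω : ℕ → Ω | 0 < sampleSize S (fun i : Fin n => ω i) ∧
      0 < empVar f g S (fun i : Fin n => ω i)}ᶜ)
    (s₂ := {ω | v ≤ dist (sampleSize S (fun i : Fin n => ω i) *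
      empVar f g S (fun i : Fin n => ω i) / n : ℝ) v}) (fun ω hω => by
      have hzero : (sampleSize S (fun i : Fin n => ω i) *
          empVar f g S (fun i : Fin n => ω i) / n : ℝ) = 0 := by
        by_cases hN : 0 < sampleSize S (fun i : Fin n => ω i)
        · have : empVar f g S (fun i : Fin n => ω i) = 0 :=
            le_antisymm (not_lt.mp fun h => hω ⟨hN, h⟩) (empVar_nonneg _)
          simp [this]
        · simp [Nat.eq_zero_of_not_pos hN]
      simp [hzero, Real.dist_eq, abs_of_pos hv])
  linarith

end Transfer

end KDISCount

end

/-- `f` are the true counts, `g` the detector counts on the discrete domain `Ω`, and for every `n`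
the sample `X n` consists of `n` independent draws from `Ω` with probability proportional to `g`.
The last two hypotheses say that the importance weights on `S` have a finite second moment
(automatic for finite `S`) and are not almost surely constant. The first part of the conclusion
says that the statistic is well defined with probability tending to one. -/
theorem claim3 {Ω : Type*} [Countable Ω] [MeasurableSpace Ω] [DiscreteMeasurableSpace Ω]
    (f g : Ω → ℝ) (hf : ∀ s, 0 ≤ f s) (hg : ∀ s, 0 ≤ g s) (hgsum : Summable g)
    (S : Set Ω) (hfg : ∀ s ∈ S, 0 < f s → 0 < g s)
    {Ξ : ℕ → Type*} [∀ n, MeasurableSpace (Ξ n)]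
    (P : ∀ n, Measure (Ξ n)) [∀ n, IsProbabilityMeasure (P n)]
    (X : ∀ n, Fin n → Ξ n → Ω) (hX : ∀ n, KDISCount.IsSample (P n) g (X n))
    (hfin : Summable fun s : S => g s * KDISCount.weight f g s ^ 2)
    (hvar : 0 < KDISCount.weightVar f g S) :
    Tendsto (fun n => (P n).real {ω | 0 < KDISCount.sampleSize S (fun i => X n i ω) ∧
      0 < KDISCount.empVar f g S (fun i => X n i ω)}) atTop (𝓝 1) ∧
    TendstoInDistribution
      (fun n ω => KDISCount.studentized f g S (fun i => X n i ω)) atTop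
      (id : ℝ → ℝ) P (gaussianReal 0 1) := by
  have hG : 0 < KDISCount.total g S := KDISCount.total_pos_of_weightVar_pos hg hvar
  have hGu : 0 < KDISCount.total g Set.univ := by
    refine hG.trans_le ?_
    simpa [KDISCount.total] using hgsum.tsum_subtype_le g S hg
  have hmX : ∀ n, Measurable fun ω i => X n i ω := fun n =>
    measurable_pi_lambda _ (hX n).measurable
  have hmE : ∀ n, Measurable fun (ω : ℕ → Ω) (i : Fin n) => ω i := fun n =>
    measurable_pi_lambda _ fun i => measurable_pi_apply (i : ℕ)
  -- The given sample of size one already supplies the one-draw law.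
  let μ : Measure Ω := (P 1).map (X 1 0)
  have : IsProbabilityMeasure μ :=
    Measure.isProbabilityMeasure_map ((hX 1).measurable 0).aemeasurable
  have hμ : ∀ s, μ.real {s} = g s / KDISCount.total g Set.univ := fun s => by
    rw [map_measureReal_apply ((hX 1).measurable 0) (measurableSet_singleton s), (hX 1).law]
  have hlaw : ∀ n, (P n).map (fun ω i => X n i ω) =
      (Measure.infinitePi fun _ : ℕ => μ).map (fun ω (i : Fin n) => ω i) := fun n =>
    (hX n).map_eq_map (KDISCount.isSample_infinitePi hμ)
  have hfsum := KDISCount.summable_of_summable_mul_weight_sq hf hg hgsum hfg hfin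
  have hv : 0 < KDISCount.total g S * KDISCount.weightVar f g S / KDISCount.total g Set.univ := by
    positivity
  have hlim := KDISCount.ae_tendsto_sampleSize_mul_empVar hf hgsum hfg hfsum hfin hG.ne' hGu.ne' hμ
  constructor
  · refine (KDISCount.tendsto_measureReal_empVar_pos hv hlim).congr fun n => ?_
    have hA : MeasurableSet {x : Fin n → Ω | 0 < KDISCount.sampleSize S x ∧
        0 < KDISCount.empVar f g S x} := .of_discrete
    have h := congrArg (fun ν : Measure (Fin n → Ω) => ν.real {x : Fin n → Ω |
      0 < KDISCount.sampleSize S x ∧ 0 < KDISCount.empVar f g S x}) (hlaw n)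
    rw [map_measureReal_apply (hmX n) hA, map_measureReal_apply
      (hmE n) hA] at h
    exact h.symm
  · have h0 : ∫ s, KDISCount.deviation f g S s ∂μ = 0 :=
      (KDISCount.integrable_indicator_and_integral_eq (S := S)
        (h := fun s => KDISCount.weight f g s - KDISCount.total f S / KDISCount.total g S) hμ
        (KDISCount.hasSum_mul_deviation hf hgsum hfg hfsum hG.ne')).2.trans (zero_div _)
    have h2 : ∫ s, KDISCount.deviation f g S s ^ 2 ∂μ =
        KDISCount.total g S * KDISCount.weightVar f g S / KDISCount.total g Set.univ := by
      rw [← (KDISCount.integrable_indicator_and_integral_eq (S := S)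
        (h := fun s => (KDISCount.weight f g s - KDISCount.total f S / KDISCount.total g S) ^ 2) hμ
        (KDISCount.hasSum_mul_deviation_sq hf hgsum hfg hfsum hfin hG.ne')).2]
      congr 1
      ext s
      by_cases hs : s ∈ S <;> simp [KDISCount.deviation, hs]
    have hdist := KDISCount.tendstoInDistribution_studentized hG.ne' hv h0 h2 hlim
    refine ⟨fun n => ((Measurable.of_discrete (f := KDISCount.studentized f g S)).comp
      (hmX n)).aemeasurable, aemeasurable_id, ?_⟩
    refine hdist.tendsto.congr fun n => Subtype.ext ?_
    have h := congrArg (Measure.map (KDISCount.studentized f g S)) (hlaw n)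
    rw [Measure.map_map Measurable.of_discrete (hmX n), Measure.map_map Measurable.of_discrete
      (hmE n)] at h
    exact h.symm
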